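/- Let $\Lambda$ be the set of untyped $\lambda$-terms (up to $\alpha$-equivalence), and for $s,t\subseteq\Lambda$ put $s\to t=\{M\in\Lambda\mid \forall P\in s,\ MP\in t\}$. **Semantics.** A set $L\subseteq\Lambda$ is an *F-set* if $s\to t\subseteq L$ for all $s,t\subseteq L$ with $s\neq\emptyset$. A *semantics* $S$ over an F-set $L$ is given by a closure operator $Cl_S$ on the subsets of $L$ such that, whenever $s,t\subseteq L$ are closed (that is, $Cl_S(s)=s$ and $Cl_S(t)=t$) and $s\ne\emptyset$, the set $s\to t$ is closed. We write $s\in S$ if $s\subseteq L$ is closed and, in case $L\neq\Lambda$, non-empty. $S$ is *adequate* if for all $s,t\in S$, every $M\in L$ and every variable $x$: if $M[P/x]\in t$ for all $P\in s$, then $\lambda x.M\in s\to t$. For semantics $S,S'$ over $L,L'$, $S\le S'$ means $Cl_S(s)\subseteq Cl_{S'}(s)$ for all $s\subseteq L\cap L'$. $S_\beta$ (resp. $S_{\beta\eta}$) is the semantics over $\Lambda$ with $Cl(s)=\{M\mid\exists M'\in s,\ M\simeq_\beta M'\}$ (resp. with $\simeq_{\beta\eta}$). **Interpretation.** For a map $\mathcal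 M$ from type variables to $S$ and a type $\sigma$ of System F (types are generated by $X\mid\sigma\to\tau\mid\forall X\sigma$), let $|X|_{\mathcal M}=\mathcal M(X)$, $|\sigma\to\tau|_{\mathcal M}=|\sigma|_{\mathcal M}\to|\tau|_{\mathcal M}$, $|\forall X\sigma|_{\mathcal M}=\bigcap_{s\in S}|\sigma|_{\mathcal M[X\mapsto s]}$, and let $|\sigma|^S=\bigcap_{\mathcal M}|\sigma|_{\mathcal M}$, over all such $\mathcal M$. **Positive types.** $\forall_2^+$ (resp. $\forall_2^-$) is the class of types in which $\forall$ occurs only in positive (resp. negative) positions: both classes contain the type variables; $\sigma\to\tau\in\forall_2^{\pm}$ iff $\sigma\in\forall_2^{\mp}$ and $\tau\in\forall_2^{\pm}$; $\forall X\sigma\in\forall_2^+$ iff $\sigma\in\forall_2^+$; and no $\forall X\sigma$ is in $\forall_2^-$. A type is *proper* if $X$ is free in $\tau$ for each of its subtypes $\forall X\tau$; $\forall^+$ is the class of proper $\forall_2^+$ types. **Theorem.** Let $S$ be an adequate semantics over an F-set $L$ such that $xP_1\cdots P_n\in L$ for every variable $x$, every $n\ge 0$ and all $P_1,\dots,P_n\in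 L$. Let $M$ be a closed $\lambda$-term and $\sigma$ a type with $M\in|\sigma|^S$. 1. If $S\le S_{\beta\eta}$ and $\sigma\in\forall_2^+$, then there is $M'\simeq_{\beta\eta}M$ such that $\vdash M':\sigma$ in System F à la Curry. 2. If $S\le S_\beta$ and $\sigma\in\forall^+$, then there is $M'\simeq_\beta M$ such that $\vdash M':\sigma$ in System F à la Curry. -/

import Mathlib

/-! ## Untyped lambda-terms

Terms up to alpha-equivalence, in de Bruijn style.  The free term variables are `x₀, x₁, x₂, …`;
below `k` binders the variable `xₙ` is written `var (n + k)`. -/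

/-- Untyped lambda-terms. -/
inductive Term : Type
  | var : ℕ → Term
  | app : Term → Term → Term
  | lam : Term → Term

namespace Term

/-- Lifting of a renaming below a binder. -/
def liftRen (f : ℕ → ℕ) : ℕ → ℕ
  | 0 => 0
  | n + 1 => f n + 1

/-- Renaming of free variables. -/
def rename : (ℕ → ℕ) → Term → Term
  | f, var n => var (f n)
  | f, app M N => app (rename f M) (rename f N)
  | f, lam M => lam (rename (liftRen f) M)

/-- Lifting of a substitution below a binder. -/
def liftSub (θ : ℕ → Term) : ℕ → Term
  | 0 => var 0
  | n + 1 => rename Nat.succ (θ n)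

/-- Simultaneous capture-avoiding substitution. -/
def subst : (ℕ → Term) → Term → Term
  | θ, var n => θ n
  | θ, app M N => app (subst θ M) (subst θ N)
  | θ, lam M => lam (subst (liftSub θ) M)

/-- Instantiation of the outermost bound variable (index `0`) of the body `M` of an abstraction:
`(λ M) N` contracts to `M.inst N`. -/
def inst (M N : Term) : Term :=
  subst (fun n => Nat.casesOn n N var) M

/-- `M[P/x]`: substitution of `P` for the free variable number `x`. -/
def substVar (x : ℕ) (P M : Term) : Term :=
  subst (fun n => if n = x then P else var n) M

/-- `λx.M`: abstraction of the free variable number `x` in `M`. -/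
def absVar (x : ℕ) (M : Term) : Term :=
  lam (rename (fun n => if n = x then 0 else n + 1) M)

/-- `M.Free n`: the variable number `n` occurs free in `M`. -/
def Free : ℕ → Term → Prop
  | n, var m => m = n
  | n, app M N => Free n M ∨ Free n N
  | n, lam M => Free (n + 1) M

/-- Closed terms. -/
def Closed (M : Term) : Prop := ∀ n, ¬ Free n M

/-- `M P₁ … Pₙ`. -/
def apps (M : Term) (Ps : List Term) : Term := Ps.foldl app M

/-- Contraction of a beta-redex at the root. -/
inductive BetaRoot : Term → Term → Prop
  | mk (M N : Term) : BetaRoot (app (lam M) N) (inst M N)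

/-- Contraction of an eta-redex `λx.Mx`, with `x` not free in `M`, at the root. -/
inductive EtaRoot : Term → Term → Prop
  | mk (M : Term) : EtaRoot (lam (app (rename Nat.succ M) (var 0))) M

/-- One-step reduction generated by a root contraction relation: contraction inside any context. -/
inductive Step (R : Term → Term → Prop) : Term → Term → Prop
  | root {M N : Term} : R M N → Step R M N
  | appL {M M' : Term} (N : Term) : Step R M M' → Step R (app M N) (app M' N)
  | appR (M : Term) {N N' : Term} : Step R N N' → Step R (app M N) (app M N')
  | lam {M M' : Term} : Step R M M' → Step R (lam M) (lam M')

/-- Convertibility: the equivalence relation generated by one-step reduction. -/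
def Conv (R : Term → Term → Prop) : Term → Term → Prop :=
  Relation.EqvGen (Step R)

/-- Beta-equivalence. -/
def BetaEq : Term → Term → Prop := Conv BetaRoot

/-- Beta-eta-equivalence. -/
def BetaEtaEq : Term → Term → Prop := Conv (fun M N => BetaRoot M N ∨ EtaRoot M N)

theorem Conv.appL {R : Term → Term → Prop} {M M' : Term} (h : Conv R M M') (N : Term) :
    Conv R (app M N) (app M' N) := by
  induction h with
  | rel _ _ h => exact .rel _ _ (.appL N h)
  | refl _ => exact .refl _
  | symm _ _ _ ih => exact .symm _ _ ih
  | trans _ _ _ _ _ ih₁ ih₂ => exact .trans _ _ _ ih₁ ih₂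

end Term

/-! ## System F in Curry style -/

/-- Types of System F, with de Bruijn indices for the bound type variables: the free type
variables are `X₀, X₁, X₂, …`, and below `k` quantifiers `Xₙ` is written `tvar (n + k)`. -/
inductive Ty : Type
  | tvar : ℕ → Ty
  | arr : Ty → Ty → Ty
  | all : Ty → Ty

namespace Ty

/-- Renaming of free type variables. -/
def rename : (ℕ → ℕ) → Ty → Ty
  | f, tvar n => tvar (f n)
  | f, arr σ τ => arr (rename f σ) (rename f τ)
  | f, all σ => all (rename (Term.liftRen f) σ)

/-- Lifting of a type substitution below a quantifier. -/
def liftSub (θ : ℕ → Ty) : ℕ → Ty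
  | 0 => tvar 0
  | n + 1 => rename Nat.succ (θ n)

/-- Simultaneous capture-avoiding substitution of types for type variables. -/
def subst : (ℕ → Ty) → Ty → Ty
  | θ, tvar n => θ n
  | θ, arr σ τ => arr (subst θ σ) (subst θ τ)
  | θ, all σ => all (subst (liftSub θ) σ)

/-- Instantiation of the quantified variable of `∀ σ` by `τ`. -/
def inst (σ τ : Ty) : Ty :=
  subst (fun n => Nat.casesOn n τ tvar) σ

/-- `σ.Free n`: the type variable number `n` occurs free in `σ`. -/
def Free : ℕ → Ty → Prop
  | n, tvar m => m = n
  | n, arr σ τ => Free n σ ∨ Free n τ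
  | n, all σ => Free (n + 1) σ

/-- The classes `∀₂⁺` (polarity `true`) and `∀₂⁻` (polarity `false`): quantifiers occur only in
positive, respectively only in negative, positions. -/
def InForall₂ : Bool → Ty → Prop
  | _, tvar _ => True
  | b, arr σ τ => InForall₂ (!b) σ ∧ InForall₂ b τ
  | b, all σ => b = true ∧ InForall₂ b σ

/-- A type is proper when each of its subtypes `∀X τ` has `X` free in `τ`. -/
def Proper : Ty → Prop
  | tvar _ => True
  | arr σ τ => Proper σ ∧ Proper τ
  | all σ => Free 0 σ ∧ Proper σ

/-- `σ ∈ ∀₂⁺`. -/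
def ForallPlus₂ (σ : Ty) : Prop := InForall₂ true σ

/-- `σ ∈ ∀⁺`: a proper `∀₂⁺` type. -/
def ForallPlus (σ : Ty) : Prop := Proper σ ∧ ForallPlus₂ σ

end Ty

/-- Typing judgements `Γ ⊢ M : σ` of System F à la Curry.  The `n`-th entry of `Γ` is the type
declared for the term variable number `n`.  In the rule for introducing `∀`, moving to the
premise shifts the free type variables of `Γ`, so the variable being generalised is bindable. -/
inductive Typing : List Ty → Term → Ty → Prop
  | id {Γ : List Ty} {n : ℕ} {σ : Ty} : Γ[n]? = some σ → Typing Γ (.var n) σ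
  | arrE {Γ : List Ty} {M N : Term} {σ τ : Ty} :
      Typing Γ M (.arr σ τ) → Typing Γ N σ → Typing Γ (.app M N) τ
  | arrI {Γ : List Ty} {M : Term} {σ τ : Ty} :
      Typing (σ :: Γ) M τ → Typing Γ (.lam M) (.arr σ τ)
  | allE {Γ : List Ty} {M : Term} {σ : Ty} (τ : Ty) :
      Typing Γ M (.all σ) → Typing Γ M (σ.inst τ)
  | allI {Γ : List Ty} {M : Term} {σ : Ty} :
      Typing (Γ.map (Ty.rename Nat.succ)) M σ → Typing Γ M (.all σ)

/-! ## Realizability semantics -/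

/-- `s → t = {M | P ∈ s ⇒ MP ∈ t}`. -/
def arrowSet (s t : Set Term) : Set Term := {M | ∀ P ∈ s, Term.app M P ∈ t}

/-- `L` is an F-set: `s → t ⊆ L` for all `s, t ⊆ L` with `s` non-empty.  (Non-empty
intersections of subsets of `L` are always subsets of `L`.) -/
def IsFSet (L : Set Term) : Prop :=
  ∀ s t : Set Term, s ⊆ L → t ⊆ L → s.Nonempty → arrowSet s t ⊆ L

/-- `cl` restricts to a closure operator on the subsets of `L` (its values on other sets are
irrelevant). -/
structure IsClosureOn (L : Set Term) (cl : Set Term → Set Term) : Prop where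
  cl_subset : ∀ s, s ⊆ L → cl s ⊆ L
  subset_cl : ∀ s, s ⊆ L → s ⊆ cl s
  mono : ∀ s t, s ⊆ t → t ⊆ L → cl s ⊆ cl t
  idem : ∀ s, s ⊆ L → cl (cl s) = cl s

/-- A realizability semantics: an F-set `L` of terms with a closure operator on the subsets of `L`
whose closed sets are stable under `s → t`, for `s` non-empty. -/
structure Semantics where
  /-- The underlying F-set. -/
  L : Set Term
  /-- The closure operator. -/
  cl : Set Term → Set Term
  isFSet : IsFSet L
  isClosureOn : IsClosureOn L cl
  arrow_closed : ∀ s t : Set Term, s ⊆ L → t ⊆ L → s.Nonempty → cl s = s → cl t = t →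
    cl (arrowSet s t) = arrowSet s t

namespace Semantics

/-- The members of the semantics: the closed subsets of `L`, the empty set being excluded unless
`L` is the set of all terms. -/
def sets (S : Semantics) : Set (Set Term) :=
  {s | s ⊆ S.L ∧ S.cl s = s ∧ (S.L ≠ Set.univ → s.Nonempty)}

/-- `S ≤ S'` (`S` is finer than `S'`). -/
instance : LE Semantics where
  le S S' := ∀ s : Set Term, s ⊆ S.L ∩ S'.L → S.cl s ⊆ S'.cl s

/-- Adequacy. -/
def Adequate (S : Semantics) : Prop :=
  ∀ s ∈ S.sets, ∀ t ∈ S.sets, ∀ M ∈ S.L, ∀ x : ℕ,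
    (∀ P ∈ s, Term.substVar x P M ∈ t) → Term.absVar x M ∈ arrowSet s t

/-- The set `L` contains `x P₁ … Pₙ` (`n ≥ 0`) for all variables `x` and `P₁, …, Pₙ ∈ L`. -/
def HasVarApps (S : Semantics) : Prop :=
  ∀ (x : ℕ) (Ps : List Term), (∀ P ∈ Ps, P ∈ S.L) → Term.apps (.var x) Ps ∈ S.L

/-- The interpretation `|σ|` of a type under an assignment of sets to the type variables. -/
def interp (S : Semantics) : (ℕ → Set Term) → Ty → Set Term
  | 𝓜, .tvar n => 𝓜 n
  | 𝓜, .arr σ τ => arrowSet (S.interp 𝓜 σ) (S.interp 𝓜 τ)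
  | 𝓜, .all σ => ⋂ s ∈ S.sets, S.interp (fun n => Nat.casesOn n s 𝓜) σ

/-- The uniform interpretation: the intersection of `|σ|` over all `S`-interpretations, i.e.
assignments of members of `S` to the type variables. -/
def uniform (S : Semantics) (σ : Ty) : Set Term :=
  {M | ∀ 𝓜 : ℕ → Set Term, (∀ n, 𝓜 n ∈ S.sets) → M ∈ S.interp 𝓜 σ}

/-- The semantics, over all terms, of the sets stable under a convertibility relation. -/
def stable (R : Term → Term → Prop) : Semantics where
  L := Set.univ
  cl s := {M | ∃ M' ∈ s, Term.Conv R M M'}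
  isFSet := fun _ _ _ _ _ => Set.subset_univ _
  isClosureOn :=
    { cl_subset := fun _ _ => Set.subset_univ _
      subset_cl := fun _ _ M hM => ⟨M, hM, .refl _⟩
      mono := fun _ _ h _ _ ⟨M', hM', e⟩ => ⟨M', h hM', e⟩
      idem := fun _ _ => Set.Subset.antisymm
        (fun _ ⟨_, ⟨N, hN, e'⟩, e⟩ => ⟨N, hN, .trans _ _ _ e e'⟩)
        (fun M hM => ⟨M, hM, .refl _⟩) }
  arrow_closed := fun s t _ _ _ _ ht => Set.Subset.antisymm
    (fun M ⟨M', hM', e⟩ P hP => by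
      rw [← ht]
      exact ⟨_, hM' P hP, e.appL P⟩)
    (fun M hM => ⟨M, hM, .refl _⟩)

/-- `S_β`: the semantics of beta-stable sets. -/
def Sβ : Semantics := stable Term.BetaRoot

/-- `S_βη`: the semantics of beta-eta-stable sets. -/
def Sβη : Semantics := stable (fun M N => Term.BetaRoot M N ∨ Term.EtaRoot M N)

end Semantics

/-!
The proof is by a syntactic interpretation.  Fix a sequence `Γ` declaring a type for every term
variable, in which every type (every proper type, for the `β` case) recurs infinitely often, and
send the type variable `Y` to the set `typableSet` of the terms of `L` convertible with a `β`-normal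
term of type `Y` in `Γ`.  This set is stable under conversion, hence closed in `S` as `S` is finer
than `S_β` or `S_βη`.  A simultaneous induction on types (`interp_typableSet`) shows that the
members of a positive type are convertible with normal terms of that type, and that a negative type
contains the terms `x P₁ … Pₙ` convertible with neutral terms of that type.  Since quantifiers are
never in negative position, instantiation is not needed, and the typed normal terms are given by the
system `NfTyping` without it.

Two steps carry the induction.

* Quantifier: if `M` belongs to `∀X σ`, then `M` has a normal form `N` of type `σ[Y/X]` for a type
  variable `Y` chosen fresh for the declarations of the free variables of `M`.  To generalize `Y` it
  has to be fresh for those of `N` too, and the free variables of `N` are among those of `M`: this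
  is confluence of `βη`, as `βη`-reduction loses no free variable of a `β`-normal term
  (`Term.Normal.free_of_conv`).
* Arrow: if `M` belongs to `σ → τ` and `x : σ` is fresh, then `M x` has a normal form `N` of
  type `τ`.  With `η`, `M` is convertible with `λx.N`.  With `β` alone this also holds as soon as
  `M` reduces to an abstraction; otherwise `N` is `M' x` with `M'` neutral, and
  for proper types no quantifier can have been generalized on the way, so that `M'` has the type
  `σ → τ` (`NfTyping.exists_conv_of_proper`).

Applied to a closed term the induction gives a closed normal term, typable in the empty context.
-/

/-! ### Renaming and substitution -/

namespace Term

theorem rename_congr {f g : ℕ → ℕ} {M : Term} (h : ∀ n, Free n M → f n = g n) :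
    rename f M = rename g M := by
  induction M generalizing f g with
  | var n => simp [rename, h n rfl]
  | app M N ihM ihN =>
    simp only [rename]
    rw [ihM fun n hn => h n (.inl hn), ihN fun n hn => h n (.inr hn)]
  | lam M ih =>
    simp only [rename]
    rw [ih (g := liftRen g)]
    rintro (_ | n) hn
    · rfl
    · simp [liftRen, h n hn]

theorem rename_id (M : Term) : rename (fun n => n) M = M := by
  induction M with
  | var n => rfl
  | app M N ihM ihN => simp [rename, ihM, ihN]
  | lam M ih =>
    have : liftRen (fun n => n) = fun n => n := by funext n; cases n <;> rfl
    simp [rename, this, ih]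

theorem rename_rename (f g : ℕ → ℕ) (M : Term) :
    rename g (rename f M) = rename (fun n => g (f n)) M := by
  induction M generalizing f g with
  | var n => rfl
  | app M N ihM ihN => simp [rename, ihM, ihN]
  | lam M ih =>
    simp only [rename, ih]
    congr 2
    funext n
    cases n <;> rfl

theorem subst_var (M : Term) : subst var M = M := by
  induction M with
  | var n => rfl
  | app M N ihM ihN => simp [subst, ihM, ihN]
  | lam M ih =>
    have : liftSub var = var := by funext n; cases n <;> rfl
    simp [subst, this, ih]

theorem subst_congr {θ η : ℕ → Term} {M : Term} (h : ∀ n, Free n M → θ n = η n) :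
    subst θ M = subst η M := by
  induction M generalizing θ η with
  | var n => exact h n rfl
  | app M N ihM ihN =>
    simp only [subst]
    rw [ihM fun n hn => h n (.inl hn), ihN fun n hn => h n (.inr hn)]
  | lam M ih =>
    simp only [subst]
    rw [ih (η := liftSub η)]
    rintro (_ | n) hn
    · rfl
    · simp [liftSub, h n hn]

theorem subst_rename (f : ℕ → ℕ) (θ : ℕ → Term) (M : Term) :
    subst θ (rename f M) = subst (fun n => θ (f n)) M := by
  induction M generalizing f θ with
  | var n => rfl
  | app M N ihM ihN => simp [subst, rename, ihM, ihN]
  | lam M ih =>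
    simp only [rename, subst, ih]
    congr 2
    funext n
    cases n <;> rfl

theorem rename_subst (f : ℕ → ℕ) (θ : ℕ → Term) (M : Term) :
    rename f (subst θ M) = subst (fun n => rename f (θ n)) M := by
  induction M generalizing f θ with
  | var n => rfl
  | app M N ihM ihN => simp [subst, rename, ihM, ihN]
  | lam M ih =>
    simp only [rename, subst, ih]
    congr 2
    funext n
    cases n with
    | zero => rfl
    | succ n => simp [liftSub, rename_rename, liftRen]

theorem subst_subst (θ η : ℕ → Term) (M : Term) :
    subst η (subst θ M) = subst (fun n => subst η (θ n)) M := by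
  induction M generalizing θ η with
  | var n => rfl
  | app M N ihM ihN => simp [subst, ihM, ihN]
  | lam M ih =>
    simp only [subst, ih]
    congr 2
    funext n
    cases n with
    | zero => rfl
    | succ n => simp [liftSub, subst_rename, rename_subst]

theorem rename_inst (f : ℕ → ℕ) (M N : Term) :
    rename f (inst M N) = inst (rename (liftRen f) M) (rename f N) := by
  simp only [inst, rename_subst, subst_rename]
  congr 1
  funext n
  cases n <;> rfl

theorem inst_rename_succ (M N : Term) : inst (rename Nat.succ M) N = M := by
  simp only [inst, subst_rename]
  exact subst_var M

theorem subst_inst (θ : ℕ → Term) (M N : Term) :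
    subst θ (inst M N) = inst (subst (liftSub θ) M) (subst θ N) := by
  simp only [inst, subst_subst]
  congr 1
  funext n
  cases n with
  | zero => rfl
  | succ n => exact (inst_rename_succ (θ n) (subst θ N)).symm

theorem rename_eq_subst (f : ℕ → ℕ) (M : Term) : rename f M = subst (fun n => var (f n)) M := by
  rw [← subst_var (rename f M), subst_rename]

theorem inst_var_zero (M : Term) : inst (rename (liftRen Nat.succ) M) (var 0) = M := by
  simp only [inst, subst_rename]
  rw [← subst_var M, subst_subst]
  congr 1
  funext n
  cases n <;> rfl

theorem rename_liftRen_succ (f : ℕ → ℕ) (M : Term) :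
    rename (liftRen f) (rename Nat.succ M) = rename Nat.succ (rename f M) := by
  simp [rename_rename, liftRen]

theorem subst_liftSub_succ (θ : ℕ → Term) (M : Term) :
    subst (liftSub θ) (rename Nat.succ M) = rename Nat.succ (subst θ M) := by
  simp [subst_rename, rename_subst, liftSub]

theorem free_rename {f : ℕ → ℕ} {M : Term} {n : ℕ} :
    Free n (rename f M) ↔ ∃ m, Free m M ∧ f m = n := by
  induction M generalizing f n with
  | var k => simp [rename, Free]
  | app M N ihM ihN =>
    simp only [rename, Free, ihM, ihN]
    grind
  | lam M ih =>
    simp only [rename, Free, ih]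
    constructor
    · rintro ⟨_ | m, hm, h⟩
      · simp [liftRen] at h
      · exact ⟨m, hm, by simpa [liftRen] using h⟩
    · rintro ⟨m, hm, h⟩
      exact ⟨m + 1, hm, by simp [liftRen, h]⟩

theorem free_rename_succ {M : Term} {n : ℕ} : Free (n + 1) (rename Nat.succ M) ↔ Free n M := by
  simp [free_rename]

theorem not_free_zero_rename_succ (M : Term) : ¬ Free 0 (rename Nat.succ M) := by
  simp [free_rename]

theorem exists_eq_rename_succ {M : Term} (h : ¬ Free 0 M) : ∃ N, M = rename Nat.succ N := by
  refine ⟨rename Nat.pred M, ?_⟩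
  rw [rename_rename]
  conv_lhs => rw [← rename_id M]
  refine rename_congr fun n hn => ?_
  cases n with
  | zero => exact absurd hn h
  | succ n => rfl

theorem liftRen_injective {f : ℕ → ℕ} (hf : f.Injective) : (liftRen f).Injective := by
  rintro (_ | m) (_ | n) h
  · rfl
  · simp [liftRen] at h
  · simp [liftRen] at h
  · simpa [liftRen, hf.eq_iff] using h

theorem rename_injective {f : ℕ → ℕ} (hf : f.Injective) : (rename f).Injective := by
  intro M N h
  induction M generalizing f N with
  | var m => cases N <;> simp_all [rename, hf.eq_iff]
  | app A B ihA ihB =>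
    cases N with
    | app C D =>
      simp only [rename, app.injEq] at h
      rw [ihA hf h.1, ihB hf h.2]
    | _ => simp [rename] at h
  | lam A ih =>
    cases N with
    | lam C =>
      simp only [rename, lam.injEq] at h
      rw [ih (liftRen_injective hf) h]
    | _ => simp [rename] at h

theorem free_subst {θ : ℕ → Term} {M : Term} {n : ℕ} :
    Free n (subst θ M) ↔ ∃ m, Free m M ∧ Free n (θ m) := by
  induction M generalizing θ n with
  | var k => simp [subst, Free]
  | app M N ihM ihN =>
    simp only [subst, Free, ihM, ihN]
    grind
  | lam M ih =>
    simp only [subst, Free, ih]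
    constructor
    · rintro ⟨_ | m, hm, h⟩
      · simp [liftSub, Free] at h
      · exact ⟨m, hm, free_rename_succ.1 h⟩
    · rintro ⟨m, hm, h⟩
      exact ⟨m + 1, hm, free_rename_succ.2 h⟩

theorem exists_free_lt (M : Term) : ∃ k, ∀ n, Free n M → n < k := by
  induction M with
  | var m => exact ⟨m + 1, fun n hn => by simp [Free] at hn; omega⟩
  | app M N ihM ihN =>
    obtain ⟨k, hk⟩ := ihM
    obtain ⟨l, hl⟩ := ihN
    refine ⟨k + l, fun n hn => ?_⟩
    rcases hn with hn | hn
    · have := hk n hn; omega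
    · have := hl n hn; omega
  | lam M ih =>
    obtain ⟨k, hk⟩ := ih
    exact ⟨k, fun n hn => by have := hk (n + 1) hn; omega⟩

/-- Opening the body of an abstraction with a fresh variable and abstracting that variable again
gives the abstraction back. -/
theorem absVar_inst_var {x : ℕ} {M : Term} (hx : ¬ Free x (lam M)) :
    absVar x (inst M (var x)) = lam M := by
  simp only [absVar, inst, rename_subst]
  congr 1
  conv_rhs => rw [← rename_id M, rename_eq_subst]
  refine subst_congr fun n hn => ?_
  cases n with
  | zero => simp [rename]
  | succ n =>
    have : n ≠ x := by rintro rfl; exact hx hn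
    simp [rename, this]

/-! ### Parallel reduction and confluence -/

/-- The root contractions: `β` for `false`, `β` and `η` for `true`. -/
def Root : Bool → Term → Term → Prop
  | false => BetaRoot
  | true => fun M N => BetaRoot M N ∨ EtaRoot M N

/-- Parallel reduction: simultaneous contraction of any set of `β`-redexes present in a term, and,
for `e = true`, of `η`-redexes too. -/
inductive Par (e : Bool) : Term → Term → Prop
  | var (n : ℕ) : Par e (var n) (var n)
  | app {M M' N N' : Term} : Par e M M' → Par e N N' → Par e (app M N) (app M' N')
  | lam {M M' : Term} : Par e M M' → Par e (lam M) (lam M')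
  | beta {M M' N N' : Term} : Par e M M' → Par e N N' → Par e (app (lam M) N) (inst M' N')
  | eta {M M' : Term} : e = true → Par e M M' →
      Par e (lam (app (Term.rename Nat.succ M) (Term.var 0))) M'

namespace Par

variable {e : Bool}

theorem refl (M : Term) : Par e M M := by
  induction M with
  | var n => exact .var n
  | app M N ihM ihN => exact .app ihM ihN
  | lam M ih => exact .lam ih

theorem rename {M M' : Term} (h : Par e M M') (f : ℕ → ℕ) :
    Par e (Term.rename f M) (Term.rename f M') := by
  induction h generalizing f with
  | var n => exact .var _
  | app _ _ ihM ihN => exact .app (ihM f) (ihN f)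
  | lam _ ih => exact .lam (ih _)
  | beta _ _ ihM ihN =>
    rw [rename_inst]
    exact .beta (ihM _) (ihN f)
  | eta he _ ih =>
    simp only [Term.rename, rename_liftRen_succ]
    exact .eta he (ih f)

theorem subst {M M' : Term} (h : Par e M M') {θ θ' : ℕ → Term} (hθ : ∀ n, Par e (θ n) (θ' n)) :
    Par e (Term.subst θ M) (Term.subst θ' M') := by
  have lift : ∀ {θ θ' : ℕ → Term}, (∀ n, Par e (θ n) (θ' n)) →
      ∀ n, Par e (liftSub θ n) (liftSub θ' n) := by
    rintro θ θ' hθ (_ | n)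
    · exact .var 0
    · exact (hθ n).rename _
  induction h generalizing θ θ' with
  | var n => exact hθ n
  | app _ _ ihM ihN => exact .app (ihM hθ) (ihN hθ)
  | lam _ ih => exact .lam (ih (lift hθ))
  | beta _ _ ihM ihN =>
    rw [subst_inst]
    exact .beta (ihM (lift hθ)) (ihN hθ)
  | eta he _ ih =>
    simp only [Term.subst, subst_liftSub_succ]
    exact .eta he (ih hθ)

theorem inst {M M' N N' : Term} (hM : Par e M M') (hN : Par e N N') :
    Par e (Term.inst M N) (Term.inst M' N') := by
  refine hM.subst ?_
  rintro (_ | n)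
  · exact hN
  · exact .var n

/-- The reducts of a renamed term are the renamed reducts. -/
theorem of_rename {f : ℕ → ℕ} (hf : f.Injective) {M P : Term} (h : Par e (Term.rename f M) P) :
    ∃ M', P = Term.rename f M' ∧ Par e M M' := by
  generalize hQ : Term.rename f M = Q at h
  induction h generalizing f M with
  | var n =>
    cases M with
    | var m =>
      cases hQ
      exact ⟨.var m, rfl, .var m⟩
    | _ => simp [Term.rename] at hQ
  | app _ _ ih₁ ih₂ =>
    cases M with
    | app A B =>
      simp only [Term.rename, Term.app.injEq] at hQ
      obtain ⟨A', rfl, hA⟩ := ih₁ hf hQ.1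
      obtain ⟨B', rfl, hB⟩ := ih₂ hf hQ.2
      exact ⟨.app A' B', rfl, .app hA hB⟩
    | _ => simp [Term.rename] at hQ
  | lam _ ih =>
    cases M with
    | lam A =>
      simp only [Term.rename, Term.lam.injEq] at hQ
      obtain ⟨A', rfl, hA⟩ := ih (liftRen_injective hf) hQ
      exact ⟨.lam A', rfl, .lam hA⟩
    | _ => simp [Term.rename] at hQ
  | beta _ _ ih₁ ih₂ =>
    cases M with
    | app A B =>
      simp only [Term.rename, Term.app.injEq] at hQ
      cases A with
      | lam A =>
        simp only [Term.rename, Term.lam.injEq] at hQ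
        obtain ⟨A', rfl, hA⟩ := ih₁ (liftRen_injective hf) hQ.1
        obtain ⟨B', rfl, hB⟩ := ih₂ hf hQ.2
        exact ⟨Term.inst A' B', (rename_inst _ _ _).symm, .beta hA hB⟩
      | _ => simp [Term.rename] at hQ
    | _ => simp [Term.rename] at hQ
  | @eta C C' he _ ih =>
    cases M with
    | lam A =>
      simp only [Term.rename, Term.lam.injEq] at hQ
      cases A with
      | app A B =>
        simp only [Term.rename, Term.app.injEq] at hQ
        obtain ⟨hA, hB⟩ := hQ
        have hB0 : B = .var 0 := by
          refine rename_injective (liftRen_injective hf) (hB.trans ?_)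
          rfl
        have h0 : ¬ Free 0 A := by
          intro h0
          refine not_free_zero_rename_succ C ?_
          rw [← hA]
          exact free_rename.2 ⟨0, h0, rfl⟩
        obtain ⟨A₀, rfl⟩ := exists_eq_rename_succ h0
        rw [rename_liftRen_succ] at hA
        obtain ⟨A', rfl, hA'⟩ := ih hf (rename_injective Nat.succ_injective hA)
        subst hB0
        exact ⟨A', rfl, .eta he hA'⟩
      | _ => simp [Term.rename] at hQ
    | _ => simp [Term.rename] at hQ

/-- The reducts of `M x`, with `x` a fresh variable. -/
theorem of_app_var_zero {M P : Term} (h : Par e (.app (Term.rename Nat.succ M) (.var 0)) P) :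
    (∃ M', P = .app (Term.rename Nat.succ M') (.var 0) ∧ Par e M M') ∨
      ∃ E, M = .lam E ∧ Par e E P := by
  generalize hQ : Term.rename Nat.succ M = Q at h
  cases h with
  | app hM hN =>
    subst hQ
    obtain ⟨M', rfl, hM'⟩ := hM.of_rename Nat.succ_injective
    cases hN
    exact .inl ⟨M', rfl, hM'⟩
  | beta hE hN =>
    cases hN
    cases M with
    | lam E =>
      simp only [Term.rename, Term.lam.injEq] at hQ
      subst hQ
      obtain ⟨E', rfl, hE'⟩ := hE.of_rename (liftRen_injective Nat.succ_injective)
      rw [inst_var_zero]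
      exact .inr ⟨E, rfl, hE'⟩
    | _ => simp [Term.rename] at hQ

theorem lam_inv {M P : Term} (h : Par e (.lam M) P) :
    (∃ M', P = .lam M' ∧ Par e M M') ∨
      ∃ N, e = true ∧ M = .app (Term.rename Nat.succ N) (.var 0) ∧ Par e N P := by
  cases h with
  | lam h => exact .inl ⟨_, rfl, h⟩
  | eta he h => exact .inr ⟨_, he, rfl, h⟩

end Par

/-- The number of nodes of a term. -/
def size : Term → ℕ
  | var _ => 1
  | app M N => size M + size N + 1
  | lam M => size M + 1

theorem size_rename (f : ℕ → ℕ) (M : Term) : size (rename f M) = size M := by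
  induction M generalizing f with
  | var n => rfl
  | app M N ihM ihN => simp [rename, size, ihM, ihN]
  | lam M ih => simp [rename, size, ih]

/-- The diamond property of parallel reduction.  The two critical pairs between `β` and `η` are
`λx.(λy.E)x` and `(λx.Mx)N`: in each of them both reducts are already reducts of the smaller term
obtained by contracting the `η`-redex. -/
theorem par_diamond {e : Bool} {M N₁ N₂ : Term} (h₁ : Par e M N₁) (h₂ : Par e M N₂) :
    ∃ P, Par e N₁ P ∧ Par e N₂ P := by
  induction hk : size M using Nat.strong_induction_on generalizing M N₁ N₂ with
  | _ k ih =>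
  subst hk
  have app_beta : ∀ {A B C D A₁ B₁ : Term}, M = app (lam A) B → Par e (lam A) C → Par e B D →
      Par e A A₁ → Par e B B₁ → ∃ P, Par e (app C D) P ∧ Par e (inst A₁ B₁) P := by
    rintro A B C D A₁ B₁ rfl hC hD hA hB
    rcases hC.lam_inv with ⟨A', rfl, hA'⟩ | ⟨A₀, -, rfl, hA₀⟩
    · obtain ⟨P, hP, hP'⟩ := ih (size A) (by simp only [size]; omega) hA' hA rfl
      obtain ⟨Q, hQ, hQ'⟩ := ih (size B) (by simp only [size]; omega) hD hB rfl
      exact ⟨_, .beta hP hQ, hP'.inst hQ'⟩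
    · refine ih (size (app A₀ B)) (by simp only [size, size_rename]; omega)
        (.app hA₀ hD) (?_ : Par e (app A₀ B) _) rfl
      rcases hA.of_app_var_zero with ⟨A', rfl, hA'⟩ | ⟨E, rfl, hE⟩
      · have : inst (app (rename Nat.succ A') (var 0)) B₁ = app A' B₁ :=
          congrArg (app · B₁) (inst_rename_succ A' B₁)
        rw [this]
        exact .app hA' hB
      · exact .beta hE hB
  have lam_eta : ∀ {A N Q : Term}, M = lam (app (rename Nat.succ A) (var 0)) → e = true →
      Par e (app (rename Nat.succ A) (var 0)) N → Par e A Q →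
      ∃ P, Par e (lam N) P ∧ Par e Q P := by
    rintro A N Q rfl he hN hQ
    have hlt : size A < size (lam (app (rename Nat.succ A) (var 0))) := by
      simp only [size, size_rename]; omega
    rcases hN.of_app_var_zero with ⟨A', rfl, hA'⟩ | ⟨E, rfl, hE⟩
    · obtain ⟨P, hP, hP'⟩ := ih _ hlt hA' hQ rfl
      exact ⟨P, .eta he hP, hP'⟩
    · exact ih _ hlt (.lam hE) hQ rfl
  cases h₁ with
  | var n => cases h₂; exact ⟨_, .var n, .var n⟩
  | app hM hN =>
    cases h₂ with
    | app hM' hN' =>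
      obtain ⟨P, hP, hP'⟩ := ih _ (by simp only [size]; omega) hM hM' rfl
      obtain ⟨Q, hQ, hQ'⟩ := ih _ (by simp only [size]; omega) hN hN' rfl
      exact ⟨_, .app hP hQ, .app hP' hQ'⟩
    | beta hA hB => exact app_beta rfl hM hN hA hB
  | lam hA =>
    cases h₂ with
    | lam hA' =>
      obtain ⟨P, hP, hP'⟩ := ih _ (by simp only [size]; omega) hA hA' rfl
      exact ⟨_, .lam hP, .lam hP'⟩
    | eta he hQ => exact lam_eta rfl he hA hQ
  | beta hA hB =>
    cases h₂ with
    | app hM hN =>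
      obtain ⟨P, hP, hP'⟩ := app_beta rfl hM hN hA hB
      exact ⟨P, hP', hP⟩
    | beta hA' hB' =>
      obtain ⟨P, hP, hP'⟩ := ih _ (by simp only [size]; omega) hA hA' rfl
      obtain ⟨Q, hQ, hQ'⟩ := ih _ (by simp only [size]; omega) hB hB' rfl
      exact ⟨_, hP.inst hQ, hP'.inst hQ'⟩
  | @eta A _ he hQ =>
    rcases h₂.lam_inv with ⟨N, rfl, hN⟩ | ⟨A', -, hA', hQ'⟩
    · obtain ⟨P, hP, hP'⟩ := lam_eta rfl he hN hQ
      exact ⟨P, hP', hP⟩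
    · simp only [app.injEq, and_true] at hA'
      cases rename_injective Nat.succ_injective hA'
      exact ih _ (by simp only [size, size_rename]; omega) hQ hQ' rfl

theorem Root.par {e : Bool} {M N : Term} (h : Root e M N) : Par e M N := by
  have beta : ∀ {M N : Term}, BetaRoot M N → Par e M N := by
    rintro _ _ ⟨M, N⟩
    exact .beta (.refl M) (.refl N)
  cases e with
  | false => exact beta h
  | true =>
    rcases h with h | h
    · exact beta h
    · cases h
      exact .eta rfl (.refl _)

theorem Step.par {e : Bool} {M N : Term} (h : Step (Root e) M N) : Par e M N := by
  induction h with
  | root h => exact h.par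
  | appL N _ ih => exact .app ih (.refl N)
  | appR M _ ih => exact .app (.refl M) ih
  | lam _ ih => exact .lam ih

theorem Conv.refl {R : Term → Term → Prop} (M : Term) : Conv R M M := Relation.EqvGen.refl M

theorem Conv.symm {R : Term → Term → Prop} {M N : Term} (h : Conv R M N) : Conv R N M :=
  Relation.EqvGen.symm _ _ h

theorem Conv.trans {R : Term → Term → Prop} {M N P : Term} (h : Conv R M N) (h' : Conv R N P) :
    Conv R M P :=
  Relation.EqvGen.trans _ _ _ h h'

theorem Conv.appR {R : Term → Term → Prop} (M : Term) {N N' : Term} (h : Conv R N N') :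
    Conv R (app M N) (app M N') := by
  induction h with
  | rel _ _ h => exact .rel _ _ (.appR M h)
  | refl _ => exact .refl _
  | symm _ _ _ ih => exact ih.symm
  | trans _ _ _ _ _ ih₁ ih₂ => exact ih₁.trans ih₂

theorem Conv.lam {R : Term → Term → Prop} {M M' : Term} (h : Conv R M M') :
    Conv R (lam M) (lam M') := by
  induction h with
  | rel _ _ h => exact .rel _ _ (.lam h)
  | refl _ => exact .refl _
  | symm _ _ _ ih => exact ih.symm
  | trans _ _ _ _ _ ih₁ ih₂ => exact ih₁.trans ih₂

theorem Conv.app {R : Term → Term → Prop} {M M' N N' : Term} (h : Conv R M M')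
    (h' : Conv R N N') : Conv R (app M N) (app M' N') :=
  (h.appL N).trans (h'.appR M')

theorem Par.conv {e : Bool} {M N : Term} (h : Par e M N) : Conv (Root e) M N := by
  induction h with
  | var n => exact .refl _
  | app _ _ ih₁ ih₂ => exact ih₁.app ih₂
  | lam _ ih => exact ih.lam
  | @beta M M' N N' _ _ ih₁ ih₂ =>
    refine (ih₁.lam.app ih₂).trans (.rel _ _ (.root ?_))
    cases e with
    | false => exact .mk M' N'
    | true => exact .inl (.mk M' N')
  | @eta M M' he _ ih =>
    subst he
    exact .trans (.rel _ _ (.root (.inr (.mk M)))) ih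

/-- Iterated parallel reduction. -/
def Red (e : Bool) : Term → Term → Prop := Relation.ReflTransGen (Par e)

theorem Red.conv {e : Bool} {M N : Term} (h : Red e M N) : Conv (Root e) M N := by
  induction h with
  | refl => exact .refl _
  | tail _ h ih => exact ih.trans h.conv

theorem Red.rename {e : Bool} {M N : Term} (h : Red e M N) (f : ℕ → ℕ) :
    Red e (rename f M) (rename f N) := by
  induction h with
  | refl => exact .refl
  | tail _ h ih => exact ih.tail (h.rename f)

theorem church_rosser {e : Bool} {M N : Term} (h : Conv (Root e) M N) :
    ∃ P, Red e M P ∧ Red e N P := by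
  have hcr : ∀ a b c, Par e a b → Par e a c →
      ∃ d, Relation.ReflGen (Par e) b d ∧ Relation.ReflTransGen (Par e) c d := by
    intro a b c hb hc
    obtain ⟨d, hd, hd'⟩ := par_diamond hb hc
    exact ⟨d, .single hd, .single hd'⟩
  induction h with
  | rel _ _ h => exact ⟨_, .single h.par, .refl⟩
  | refl _ => exact ⟨_, .refl, .refl⟩
  | symm _ _ _ ih => exact ih.imp fun _ h => h.symm
  | trans _ _ _ _ _ ih₁ ih₂ =>
    obtain ⟨P, hP, hP'⟩ := ih₁
    obtain ⟨Q, hQ, hQ'⟩ := ih₂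
    obtain ⟨T, hT, hT'⟩ := Relation.church_rosser hcr hP' hQ
    exact ⟨T, hP.trans hT, hQ'.trans hT'⟩

theorem Conv.rename {e : Bool} {M N : Term} (h : Conv (Root e) M N) (f : ℕ → ℕ) :
    Conv (Root e) (rename f M) (rename f N) := by
  obtain ⟨P, hP, hP'⟩ := church_rosser h
  exact (hP.rename f).conv.trans (hP'.rename f).conv.symm

theorem Conv.absVar {e : Bool} {M N : Term} (h : Conv (Root e) M N) (x : ℕ) :
    Conv (Root e) (absVar x M) (absVar x N) :=
  (h.rename _).lam

/-- `λx.Mx` is `η`-equal to `M` for `x` fresh. -/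
theorem conv_absVar_app {x : ℕ} {M : Term} (hx : ¬ Free x M) :
    Conv (Root true) (absVar x (app M (var x))) M := by
  have : absVar x (app M (var x)) = lam (app (rename Nat.succ M) (var 0)) := by
    simp only [absVar, rename, if_true]
    congr 2
    refine rename_congr fun n hn => if_neg ?_
    rintro rfl
    exact hx hn
  rw [this]
  exact .rel _ _ (.root (.inr (.mk M)))

/-! ### Free variables and normal forms -/

theorem Par.free {e : Bool} {M N : Term} (h : Par e M N) {n : ℕ} (hn : Free n N) : Free n M := by
  induction h generalizing n with
  | var _ => exact hn
  | app _ _ ih₁ ih₂ => exact hn.imp ih₁ ih₂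
  | lam _ ih => exact ih hn
  | beta _ _ ih₁ ih₂ =>
    obtain ⟨_ | m, hm, hm'⟩ := free_subst.1 hn
    · exact .inr (ih₂ hm')
    · cases hm'
      exact .inl (ih₁ hm)
  | eta _ _ ih => exact .inl (free_rename_succ.2 (ih hn))

theorem Red.free {e : Bool} {M N : Term} (h : Red e M N) {n : ℕ} (hn : Free n N) : Free n M := by
  induction h with
  | refl => exact hn
  | tail _ h ih => exact ih (h.free hn)

/-- Abstractions. -/
def IsLam (M : Term) : Prop := ∃ N, M = lam N

theorem isLam_rename {f : ℕ → ℕ} {M : Term} : IsLam (rename f M) ↔ IsLam M := by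
  cases M <;> simp [IsLam, rename]

/-- `β`-normal terms. -/
def Normal : Term → Prop
  | var _ => True
  | app M N => ¬ IsLam M ∧ Normal M ∧ Normal N
  | lam M => Normal M

theorem normal_rename {f : ℕ → ℕ} {M : Term} : Normal (rename f M) ↔ Normal M := by
  induction M generalizing f with
  | var n => rfl
  | app M N ihM ihN => simp [rename, Normal, isLam_rename, ihM, ihN]
  | lam M ih => simp [rename, Normal, ih]

theorem Normal.par_eq {M N : Term} (hM : Normal M) (h : Par false M N) : N = M := by
  induction h with
  | var n => rfl
  | app _ _ ih₁ ih₂ => rw [ih₁ hM.2.1, ih₂ hM.2.2]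
  | lam _ ih => rw [ih hM]
  | beta _ _ _ _ => exact absurd ⟨_, rfl⟩ hM.1
  | eta he _ _ => exact absurd he (by simp)

theorem Normal.red_eq {M N : Term} (hM : Normal M) (h : Red false M N) : N = M := by
  induction h with
  | refl => rfl
  | tail _ h ih =>
    subst ih
    exact hM.par_eq h

/-- Reduction of a `β`-normal term only contracts `η`-redexes; it yields `β`-normal terms and
loses no free variable. -/
theorem Normal.par {e : Bool} {M N : Term} (hM : Normal M) (h : Par e M N) :
    Normal N ∧ (IsLam N → IsLam M) ∧ ∀ n, Free n M → Free n N := by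
  induction h with
  | var n => exact ⟨hM, id, fun _ => id⟩
  | app _ _ ih₁ ih₂ =>
    obtain ⟨h₁, h₁', h₁''⟩ := ih₁ hM.2.1
    obtain ⟨h₂, -, h₂''⟩ := ih₂ hM.2.2
    exact ⟨⟨fun h => hM.1 (h₁' h), h₁, h₂⟩, fun ⟨_, h⟩ => by simp at h,
      fun n => Or.imp (h₁'' n) (h₂'' n)⟩
  | lam _ ih =>
    obtain ⟨h₁, -, h₁''⟩ := ih hM
    exact ⟨h₁, fun _ => ⟨_, rfl⟩, fun n => h₁'' (n + 1)⟩
  | beta _ _ _ _ => exact absurd ⟨_, rfl⟩ hM.1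
  | eta he _ ih =>
    obtain ⟨h₁, -, h₁''⟩ := ih (normal_rename.1 hM.2.1)
    refine ⟨h₁, fun _ => ⟨_, rfl⟩, fun n hn => ?_⟩
    rcases hn with hn | hn
    · exact h₁'' n (free_rename_succ.1 hn)
    · simp [Free] at hn

/-- The free variables of a `β`-normal form of `M` (up to `β` or `βη`) occur free in `M`. -/
theorem Normal.free_of_conv {e : Bool} {M N : Term} (hN : Normal N) (h : Conv (Root e) M N)
    {n : ℕ} (hn : Free n N) : Free n M := by
  obtain ⟨P, hP, hP'⟩ := church_rosser h
  suffices Normal P ∧ Free n P from hP.free this.2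
  clear hP h
  induction hP' with
  | refl => exact ⟨hN, hn⟩
  | tail _ h ih => exact ⟨(ih.1.par h).1, (ih.1.par h).2.2 n ih.2⟩

/-- The reducts of `M x`: either the application survives, or `M` reduces to an abstraction. -/
theorem Red.of_app_var {e : Bool} {M N : Term} {x : ℕ} (h : Red e (app M (var x)) N) :
    (∃ M', Red e M M' ∧ N = app M' (var x)) ∨
      ∃ Q, Red e M (lam Q) ∧ Red e (inst Q (var x)) N := by
  induction h with
  | refl => exact .inl ⟨M, .refl, rfl⟩
  | tail _ h ih =>
    rcases ih with ⟨M', hM', rfl⟩ | ⟨Q, hQ, hQ'⟩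
    · cases h with
      | app h₁ h₂ =>
        cases h₂
        exact .inl ⟨_, hM'.tail h₁, rfl⟩
      | beta h₁ h₂ =>
        cases h₂
        exact .inr ⟨_, hM'.tail (.lam h₁), .refl⟩
    · exact .inr ⟨Q, hQ, hQ'.tail h⟩

end Term

/-! ### Type variables -/

namespace Ty

theorem rename_congr {f g : ℕ → ℕ} {σ : Ty} (h : ∀ n, Free n σ → f n = g n) :
    rename f σ = rename g σ := by
  induction σ generalizing f g with
  | tvar n => simp [rename, h n rfl]
  | arr σ τ ihσ ihτ =>
    simp only [rename]
    rw [ihσ fun n hn => h n (.inl hn), ihτ fun n hn => h n (.inr hn)]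
  | all σ ih =>
    simp only [rename]
    rw [ih (g := Term.liftRen g)]
    rintro (_ | n) hn
    · rfl
    · simp [Term.liftRen, h n hn]

theorem rename_id (σ : Ty) : rename (fun n => n) σ = σ := by
  induction σ with
  | tvar n => rfl
  | arr σ τ ihσ ihτ => simp [rename, ihσ, ihτ]
  | all σ ih =>
    have : Term.liftRen (fun n => n) = fun n => n := by funext n; cases n <;> rfl
    simp [rename, this, ih]

theorem rename_rename (f g : ℕ → ℕ) (σ : Ty) :
    rename g (rename f σ) = rename (fun n => g (f n)) σ := by
  induction σ generalizing f g with
  | tvar n => rfl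
  | arr σ τ ihσ ihτ => simp [rename, ihσ, ihτ]
  | all σ ih =>
    simp only [rename, ih]
    congr 2
    funext n
    cases n <;> rfl

theorem rename_liftRen_succ (f : ℕ → ℕ) (σ : Ty) :
    rename (Term.liftRen f) (rename Nat.succ σ) = rename Nat.succ (rename f σ) := by
  simp [rename_rename, Term.liftRen]

theorem free_rename {f : ℕ → ℕ} {σ : Ty} {n : ℕ} :
    Free n (rename f σ) ↔ ∃ m, Free m σ ∧ f m = n := by
  induction σ generalizing f n with
  | tvar k => simp [rename, Free]
  | arr σ τ ihσ ihτ =>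
    simp only [rename, Free, ihσ, ihτ]
    grind
  | all σ ih =>
    simp only [rename, Free, ih]
    constructor
    · rintro ⟨_ | m, hm, h⟩
      · simp [Term.liftRen] at h
      · exact ⟨m, hm, by simpa [Term.liftRen] using h⟩
    · rintro ⟨m, hm, h⟩
      exact ⟨m + 1, hm, by simp [Term.liftRen, h]⟩

theorem not_free_zero_rename_succ (σ : Ty) : ¬ Free 0 (rename Nat.succ σ) := by
  simp [free_rename]

theorem exists_free_lt (σ : Ty) : ∃ k, ∀ n, Free n σ → n < k := by
  induction σ with
  | tvar m => exact ⟨m + 1, fun n hn => by simp [Free] at hn; omega⟩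
  | arr σ τ ihσ ihτ =>
    obtain ⟨k, hk⟩ := ihσ
    obtain ⟨l, hl⟩ := ihτ
    refine ⟨k + l, fun n hn => ?_⟩
    rcases hn with hn | hn
    · have := hk n hn; omega
    · have := hl n hn; omega
  | all σ ih =>
    obtain ⟨k, hk⟩ := ih
    exact ⟨k, fun n hn => by have := hk (n + 1) hn; omega⟩

theorem proper_rename {f : ℕ → ℕ} {σ : Ty} : Proper (rename f σ) ↔ Proper σ := by
  induction σ generalizing f with
  | tvar n => rfl
  | arr σ τ ihσ ihτ => simp [rename, Proper, ihσ, ihτ]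
  | all σ ih =>
    have h0 : Free 0 (rename (Term.liftRen f) σ) ↔ Free 0 σ := by
      rw [free_rename]
      constructor
      · rintro ⟨_ | m, hm, h⟩
        · exact hm
        · simp [Term.liftRen] at h
      · exact fun h => ⟨0, h, rfl⟩
    simp [rename, Proper, h0, ih]

/-- An injective code of types by natural numbers. -/
def code : Ty → ℕ
  | tvar n => Nat.pair 0 n
  | arr σ τ => Nat.pair 1 (Nat.pair (code σ) (code τ))
  | all σ => Nat.pair 2 (code σ)

theorem code_injective : code.Injective := by
  intro σ τ h
  induction σ generalizing τ with
  | tvar n => cases τ <;> simp_all [code, Nat.pair_eq_pair]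
  | arr σ₁ σ₂ ih₁ ih₂ =>
    cases τ with
    | arr τ₁ τ₂ =>
      simp only [code, Nat.pair_eq_pair, true_and] at h
      rw [ih₁ h.1, ih₂ h.2]
    | _ => simp [code, Nat.pair_eq_pair] at h
  | all σ ih =>
    cases τ with
    | all τ =>
      simp only [code, Nat.pair_eq_pair, true_and] at h
      rw [ih h]
    | _ => simp [code, Nat.pair_eq_pair] at h

instance : Countable Ty := code_injective.countable

/-- Any non-empty class of types is enumerated by a sequence in which each member of the class
recurs infinitely often. -/
theorem exists_declarations (K : Ty → Prop) (hK : ∃ σ, K σ) :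
    ∃ Γ : ℕ → Ty, (∀ n, K (Γ n)) ∧ ∀ σ, K σ → ∀ k, ∃ x, k ≤ x ∧ Γ x = σ := by
  obtain ⟨σ₀, h₀⟩ := hK
  have : Nonempty {σ // K σ} := ⟨⟨σ₀, h₀⟩⟩
  obtain ⟨e, he⟩ := exists_surjective_nat {σ // K σ}
  refine ⟨fun n => e (Nat.unpair n).1, fun n => (e _).2, fun σ hσ k => ?_⟩
  obtain ⟨a, ha⟩ := he ⟨σ, hσ⟩
  exact ⟨Nat.pair a k, Nat.right_le_pair a k, by simp [ha]⟩

end Ty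

/-! ### Typing of normal terms without instantiation -/

/-- Extension of a declaration of all variables by a type for the variable number `0`. -/
def extend (σ : Ty) (Γ : ℕ → Ty) : ℕ → Ty
  | 0 => σ
  | n + 1 => Γ n

/-- Typing of `β`-normal terms in the fragment of System F without instantiation of quantifiers,
where `Γ` declares a type for each of the infinitely many variables.  The judgements
`NfTyping true Γ M σ` concern the neutral terms `x N₁ … Nₖ`, whose type is then a subtype
of the declared type of `x`; the judgements `NfTyping false Γ M σ` concern all normal terms. -/
inductive NfTyping : Bool → (ℕ → Ty) → Term → Ty → Prop
  | var (Γ : ℕ → Ty) (n : ℕ) : NfTyping true Γ (.var n) (Γ n)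
  | app {Γ : ℕ → Ty} {M N : Term} {σ τ : Ty} :
      NfTyping true Γ M (.arr σ τ) → NfTyping false Γ N σ → NfTyping true Γ (.app M N) τ
  | neutral {Γ : ℕ → Ty} {M : Term} {σ : Ty} : NfTyping true Γ M σ → NfTyping false Γ M σ
  | lam {Γ : ℕ → Ty} {M : Term} {σ τ : Ty} :
      NfTyping false (extend σ Γ) M τ → NfTyping false Γ (.lam M) (.arr σ τ)
  | all {Γ : ℕ → Ty} {M : Term} {σ : Ty} :
      NfTyping false (fun n => (Γ n).rename Nat.succ) M σ → NfTyping false Γ M (.all σ)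

namespace NfTyping

open Term

variable {b : Bool} {Γ : ℕ → Ty} {M : Term} {σ : Ty}

theorem normal_and_not_isLam (h : NfTyping b Γ M σ) : Normal M ∧ (b = true → ¬ IsLam M) := by
  induction h with
  | var => exact ⟨trivial, fun _ ⟨_, h⟩ => by simp at h⟩
  | app _ _ ih₁ ih₂ => exact ⟨⟨ih₁.2 rfl, ih₁.1, ih₂.1⟩, fun _ ⟨_, h⟩ => by simp at h⟩
  | neutral _ ih => exact ⟨ih.1, fun h => by simp at h⟩
  | lam _ ih => exact ⟨ih.1, fun h => by simp at h⟩
  | all _ ih => exact ⟨ih.1, fun h => by simp at h⟩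

theorem normal (h : NfTyping b Γ M σ) : Normal M := h.normal_and_not_isLam.1

theorem rename (h : NfTyping b Γ M σ) {Δ : ℕ → Ty} {f : ℕ → ℕ}
    (hf : ∀ n, Free n M → Δ (f n) = Γ n) : NfTyping b Δ (Term.rename f M) σ := by
  induction h generalizing Δ f with
  | var Γ n =>
    rw [← hf n rfl]
    exact .var _ _
  | app _ _ ih₁ ih₂ =>
    exact .app (ih₁ fun n hn => hf n (.inl hn)) (ih₂ fun n hn => hf n (.inr hn))
  | neutral _ ih => exact .neutral (ih hf)
  | lam _ ih =>
    refine .lam (ih ?_)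
    rintro (_ | n) hn
    · rfl
    · exact hf n hn
  | all _ ih => exact .all (ih fun n hn => by rw [hf n hn])

theorem congr (h : NfTyping b Γ M σ) {Δ : ℕ → Ty} (hΔ : ∀ n, Free n M → Δ n = Γ n) :
    NfTyping b Δ M σ := by
  have := h.rename (f := fun n => n) hΔ
  rwa [Term.rename_id] at this

theorem absVar (h : NfTyping false Γ M σ) (x : ℕ) :
    NfTyping false Γ (absVar x M) (.arr (Γ x) σ) := by
  refine .lam (h.rename fun n _ => ?_)
  split_ifs with hn
  · rw [hn, extend]
  · rfl

theorem rename_type (h : NfTyping b Γ M σ) (f : ℕ → ℕ) :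
    NfTyping b (fun n => (Γ n).rename f) M (σ.rename f) := by
  induction h generalizing f with
  | var Γ n => exact .var (fun n => (Γ n).rename f) n
  | app _ _ ih₁ ih₂ => exact .app (ih₁ f) (ih₂ f)
  | neutral _ ih => exact .neutral (ih f)
  | lam _ ih =>
    refine .lam ((ih f).congr ?_)
    rintro (_ | n) -
    · rfl
    · rfl
  | all _ ih =>
    refine .all ((ih (liftRen f)).congr fun n _ => ?_)
    exact (Ty.rename_liftRen_succ f _).symm

theorem typing (h : NfTyping b Γ M σ) {Δ : List Ty}
    (hΔ : ∀ n, Free n M → Δ[n]? = some (Γ n)) : Typing Δ M σ := by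
  induction h generalizing Δ with
  | var Γ n => exact .id (hΔ n rfl)
  | app _ _ ih₁ ih₂ =>
    exact .arrE (ih₁ fun n hn => hΔ n (.inl hn)) (ih₂ fun n hn => hΔ n (.inr hn))
  | neutral _ ih => exact ih hΔ
  | lam _ ih =>
    refine .arrI (ih ?_)
    rintro (_ | n) hn
    · rfl
    · exact hΔ n hn
  | all _ ih => exact .allI (ih fun n hn => by simp [hΔ n hn])

/-- The type of a neutral term is a subtype of a declared type, so it is proper and has no new
free variable. -/
theorem neutral_type (h : NfTyping true Γ M σ) :
    ((∀ n, (Γ n).Proper) → σ.Proper) ∧ ∀ i, σ.Free i → ∃ n, (Γ n).Free i := by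
  generalize hb : true = b at h
  induction h with
  | var Γ n => exact ⟨fun h => h n, fun i hi => ⟨n, hi⟩⟩
  | app _ _ ih _ =>
    exact ⟨fun h => ((ih rfl).1 h).2, fun i hi => (ih rfl).2 i (.inr hi)⟩
  | neutral | lam | all => simp at hb

/-- A term which is not an abstraction receives a proper type as a neutral term only: generalizing
the type of a neutral term only yields vacuous quantifiers. -/
theorem neutral_of_proper (h : NfTyping false Γ M σ) (hM : ¬ IsLam M) (hσ : σ.Proper) :
    NfTyping true Γ M σ := by
  generalize hb : false = b at h
  induction h with
  | var | app => simp at hb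
  | neutral h _ => exact h
  | lam => exact absurd ⟨_, rfl⟩ hM
  | all _ ih =>
    obtain ⟨n, hn⟩ := (ih hM hσ.2 rfl).neutral_type.2 0 hσ.1
    exact absurd hn (Ty.not_free_zero_rename_succ _)

/-- For `β` alone, with proper types: if `M x` has, up to `β`, a normal form of type `τ`, then `M`
has a normal form of type `Γ x → τ`.  When that normal form is `M' x` with `M'` neutral, properness
forces the type of `M'` to be `Γ x → τ`; otherwise `M` reduces to an abstraction. -/
theorem exists_conv_of_proper {N : Term} {x : ℕ} {τ : Ty} (hΓ : ∀ n, (Γ n).Proper)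
    (hτ : τ.Proper) (hx : ¬ Free x M) (h : Conv (Root false) (.app M (.var x)) N)
    (hN : NfTyping false Γ N τ) :
    ∃ N', Conv (Root false) M N' ∧ NfTyping false Γ N' (.arr (Γ x) τ) := by
  obtain ⟨P, hP, hP'⟩ := church_rosser h
  obtain rfl := hN.normal.red_eq hP'
  rcases hP.of_app_var with ⟨M', hM', rfl⟩ | ⟨Q, hQ, hQ'⟩
  · refine ⟨M', hM'.conv, .neutral ?_⟩
    cases hN.neutral_of_proper (fun ⟨_, h⟩ => by simp at h) hτ with
    | app h₁ h₂ =>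
      have h₂' := h₂.neutral_of_proper (fun ⟨_, h⟩ => by simp at h) (h₁.neutral_type.1 hΓ).1
      cases h₂'
      exact h₁
  · refine ⟨Term.absVar x P, hQ.conv.trans ?_, hN.absVar x⟩
    rw [← absVar_inst_var fun hf => hx (hQ.free hf)]
    exact hQ'.conv.absVar x

/-- Introduction of an arrow type: if `M x` has a normal form of type `τ`, with `x` fresh, then `M`
has a normal form of type `Γ x → τ`. -/
theorem exists_conv {e : Bool} {N : Term} {x : ℕ} {τ : Ty} (hΓ : ∀ n, e = false → (Γ n).Proper)
    (hτ : e = false → τ.Proper) (hx : ¬ Free x M) (h : Conv (Root e) (.app M (.var x)) N)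
    (hN : NfTyping false Γ N τ) :
    ∃ N', Conv (Root e) M N' ∧ NfTyping false Γ N' (.arr (Γ x) τ) := by
  cases e with
  | false => exact hN.exists_conv_of_proper (fun n => hΓ n rfl) (hτ rfl) hx h
  | true => exact ⟨_, (conv_absVar_app hx).symm.trans (h.absVar x), hN.absVar x⟩

/-- Generalization of a type variable `Y` which does not occur in the declarations of the free
variables of the term. -/
theorem generalize_fresh {Y : ℕ} {ρ : ℕ → ℕ} (hΓ : ∀ n, Free n M → ¬ (Γ n).Free Y)
    (hY : ¬ ((Ty.all σ).rename ρ).Free Y)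
    (h : NfTyping false Γ M (σ.rename fun n => Nat.casesOn n Y ρ)) :
    NfTyping false Γ M ((Ty.all σ).rename ρ) := by
  refine .all ?_
  have h' := h.rename_type fun Z => if Z = Y then 0 else Z + 1
  have hσ : (σ.rename fun n => Nat.casesOn n Y ρ).rename (fun Z => if Z = Y then 0 else Z + 1) =
      σ.rename (liftRen ρ) := by
    rw [Ty.rename_rename]
    refine Ty.rename_congr ?_
    rintro (_ | n) hn
    · simp [liftRen]
    · refine if_neg ?_
      exact fun hn' => hY (Ty.free_rename.2 ⟨n, hn, hn'⟩)
  rw [hσ] at h'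
  refine h'.congr fun n hn => Ty.rename_congr fun Z hZ => (if_neg ?_).symm
  rintro rfl
  exact hΓ n hn hZ

end NfTyping

/-! ### Completeness -/

namespace Semantics

open Term

variable {e : Bool} {Γ : ℕ → Ty} {S : Semantics}

/-- The terms of `L` convertible with a normal term of type `Y`; this is the value of the type
variable `Y` in the syntactic interpretation. -/
def typableSet (e : Bool) (Γ : ℕ → Ty) (S : Semantics) (Y : ℕ) : Set Term :=
  {M | M ∈ S.L ∧ ∃ N, Conv (Root e) M N ∧ NfTyping false Γ N (.tvar Y)}

theorem typableSet_mem_sets (hS : S ≤ stable (Root e)) (hL : S.HasVarApps)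
    (hΓ : ∀ Y, ∃ x, Γ x = .tvar Y) (Y : ℕ) : typableSet e Γ S Y ∈ S.sets := by
  have hsub : typableSet e Γ S Y ⊆ S.L := fun _ h => h.1
  refine ⟨hsub, (S.isClosureOn.subset_cl _ hsub).antisymm' ?_, fun _ => ?_⟩
  · intro M hM
    obtain ⟨M', ⟨-, N, hN, hN'⟩, hMM'⟩ := hS _ (fun _ h => ⟨h.1, trivial⟩) hM
    exact ⟨S.isClosureOn.cl_subset _ hsub hM, N, hMM'.trans hN, hN'⟩
  · obtain ⟨x, hx⟩ := hΓ Y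
    refine ⟨.var x, hL x [] (by simp), .var x, .refl _, .neutral ?_⟩
    rw [← hx]
    exact .var Γ x

/-- The interpretation of types in the syntactic interpretation, where the type variable `n` is
sent to `typableSet e Γ S (ρ n)`.  The members of a positive type are typable up to
conversion, and a negative type contains the terms `x P₁ … Pₙ` which are convertible with a
typable `x N₁ … Nₙ`. -/
theorem interp_typableSet (hS : S ≤ stable (Root e)) (hL : S.HasVarApps)
    (hΓ : ∀ n, e = false → (Γ n).Proper)
    (hΓ' : ∀ σ : Ty, (e = false → σ.Proper) → ∀ k, ∃ x, k ≤ x ∧ Γ x = σ)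
    (σ : Ty) (ρ : ℕ → ℕ) (hσ : e = false → σ.Proper) :
    (σ.InForall₂ true → ∀ M ∈ S.interp (fun n => typableSet e Γ S (ρ n)) σ,
      M ∈ S.L ∧ ∃ N, Conv (Root e) M N ∧ NfTyping false Γ N (σ.rename ρ)) ∧
    (σ.InForall₂ false → ∀ (x : ℕ) (Ps : List Term) (N : Term), (∀ P ∈ Ps, P ∈ S.L) →
      Conv (Root e) (apps (.var x) Ps) N → NfTyping true Γ N (σ.rename ρ) →
      apps (.var x) Ps ∈ S.interp (fun n => typableSet e Γ S (ρ n)) σ) := by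
  induction σ generalizing ρ with
  | tvar n => exact ⟨fun _ M hM => hM, fun _ x Ps N hPs hN hN' => ⟨hL x Ps hPs, N, hN, .neutral hN'⟩⟩
  | arr σ τ ihσ ihτ =>
    have ihσ := ihσ ρ fun h => (hσ h).1
    have ihτ := ihτ ρ fun h => (hσ h).2
    refine ⟨fun hpos M hM => ?_, fun hneg x Ps N hPs hN hN' P hP => ?_⟩
    · -- The variables declared with the type `σ` belong to the interpretation of `σ`.
      have hvar : ∀ x, Γ x = σ.rename ρ →
          Term.var x ∈ S.interp (fun n => typableSet e Γ S (ρ n)) σ := fun x hx =>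
        ihσ.2 hpos.1 x [] (.var x) (by simp) (.refl _) (hx ▸ .var Γ x)
      obtain ⟨k, hk⟩ := M.exists_free_lt
      obtain ⟨x, hkx, hx⟩ := hΓ' (σ.rename ρ) (fun h => Ty.proper_rename.2 (hσ h).1) k
      refine ⟨?_, ?_⟩
      · -- The interpretation of `σ` need not be contained in `L`, but its trace on `L` will do.
        exact S.isFSet (S.interp _ σ ∩ S.L) (S.interp _ τ) Set.inter_subset_right
          (fun P hP => (ihτ.1 hpos.2 P hP).1) ⟨.var x, hvar x hx, hL x [] (by simp)⟩
          fun P hP => hM P hP.1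
      · obtain ⟨-, N, hN, hN'⟩ := ihτ.1 hpos.2 _ (hM _ (hvar x hx))
        have := hN'.exists_conv hΓ (fun h => Ty.proper_rename.2 (hσ h).2)
          (fun hf => (hk x hf).not_ge hkx) hN
        rwa [hx] at this
    · obtain ⟨hPL, Q, hQ, hQ'⟩ := ihσ.1 hneg.1 P hP
      have happ : apps (.var x) (Ps ++ [P]) = .app (apps (.var x) Ps) P := by simp [apps]
      have := ihτ.2 hneg.2 x (Ps ++ [P]) (.app N Q)
        (fun R hR => by
          rcases List.mem_append.1 hR with hR | hR
          · exact hPs R hR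
          · rwa [List.mem_singleton.1 hR])
        (by rw [happ]; exact hN.app hQ) (.app hN' hQ')
      rwa [happ] at this
  | all σ ih =>
    refine ⟨fun hpos M hM => ?_, fun hneg => absurd hneg.1 (by simp)⟩
    -- `Y` is a type variable fresh for the type and for the declarations of the free variables
    -- of `M`.
    obtain ⟨Y, hY, hYΓ⟩ : ∃ Y, ¬ ((Ty.all σ).rename ρ).Free Y ∧
        ∀ n, Free n M → ¬ (Γ n).Free Y := by
      obtain ⟨k, hk⟩ := M.exists_free_lt
      obtain ⟨l, hl⟩ := ((Ty.all σ).rename ρ).exists_free_lt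
      choose B hB using fun n => (Γ n).exists_free_lt
      refine ⟨l + ∑ n ∈ Finset.range k, B n, fun h => ?_, fun n hn h => ?_⟩
      · have := hl _ h
        omega
      · have h₁ := hB n _ h
        have h₂ := Finset.single_le_sum (f := B) (fun _ _ => Nat.zero_le _)
          (Finset.mem_range.2 (hk n hn))
        omega
    have hYmem := typableSet_mem_sets hS hL
      (fun Y => (hΓ' (.tvar Y) (fun _ => trivial) 0).imp fun _ h => h.2) Y
    have hM' := Set.mem_iInter₂.1 hM _ hYmem
    have henv : (fun n => Nat.casesOn n (typableSet e Γ S Y) fun n => typableSet e Γ S (ρ n) :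
        ℕ → Set Term) = fun n => typableSet e Γ S (Nat.casesOn n Y ρ) := by
      funext n
      cases n <;> rfl
    rw [henv] at hM'
    obtain ⟨hML, N, hN, hN'⟩ := (ih (fun n => Nat.casesOn n Y ρ) fun h => (hσ h).2).1 hpos.2 M hM'
    exact ⟨hML, N, hN, hN'.generalize_fresh
      (fun n hn => hYΓ n (hN'.normal.free_of_conv hN hn)) hY⟩

/-- Completeness for positive types, up to `βη`, or up to `β` for proper types. -/
theorem exists_typing_of_mem_uniform (hS : S ≤ stable (Root e)) (hL : S.HasVarApps) {M : Term}
    (hM : M.Closed) {σ : Ty} (hMσ : M ∈ S.uniform σ) (hσ : σ.ForallPlus₂)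
    (hσ' : e = false → σ.Proper) : ∃ N, Conv (Root e) N M ∧ Typing [] N σ := by
  obtain ⟨Γ, hΓ, hΓ'⟩ := Ty.exists_declarations (fun σ => e = false → σ.Proper)
    ⟨.tvar 0, fun _ => trivial⟩
  have hmem := hMσ (typableSet e Γ S) (typableSet_mem_sets hS hL
    (fun Y => (hΓ' (.tvar Y) (fun _ => trivial) 0).imp fun _ h => h.2))
  obtain ⟨-, N, hN, hN'⟩ := (interp_typableSet hS hL hΓ hΓ' σ (fun n => n) hσ').1 hσ M hmem
  rw [Ty.rename_id] at hN'
  exact ⟨N, hN.symm, hN'.typing fun n hn => absurd (hN'.normal.free_of_conv hN hn) (hM n)⟩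

end Semantics

theorem mainTheorem1 (S : Semantics) (hS : S.Adequate) (hL : S.HasVarApps)
    (M : Term) (hM : M.Closed) (σ : Ty) (hMσ : M ∈ S.uniform σ) :
    (S ≤ Semantics.Sβη → σ.ForallPlus₂ →
      ∃ M' : Term, Term.BetaEtaEq M' M ∧ Typing [] M' σ) ∧
    (S ≤ Semantics.Sβ → σ.ForallPlus →
      ∃ M' : Term, Term.BetaEq M' M ∧ Typing [] M' σ) :=
  ⟨fun h hσ => Semantics.exists_typing_of_mem_uniform (e := true) h hL hM hMσ hσ (by simp),
    fun h hσ => Semantics.exists_typing_of_mem_uniform (e := false) h hL hM hMσ hσ.2 fun _ => hσ.1⟩
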